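/- Let $\{\Theta_t, t\ge 1\}$ be a sequence of (strictly) positive random variables, with arbitrary dependence between them, and let $\alpha>0$. Suppose that for some $\epsilon\in(0,\alpha)$ $$\sum_{t=1}^\infty \mathbb E\big[\Theta_t^{\alpha+\epsilon}+\Theta_t^{\alpha-\epsilon}\big]<\infty \quad\text{if } 0<\alpha<1,\qquad \sum_{t=1}^\infty \Big(\mathbb E\big[\Theta_t^{\alpha+\epsilon}+\Theta_t^{\alpha-\epsilon}\big]\Big)^{\frac1{\alpha+\epsilon}}<\infty\quad\text{if } \alpha\ge 1,$$ but that $\sum_{t=1}^\infty \mathbb E[\Theta_t^{\alpha+i\beta_0}]=0$ for some $\beta_0\in\mathbb R$. Then, on a suitable extension of the probability space of $\{\Theta_t\}$, there exists a sequence $\{X_t, t\ge 1\}$ of i.i.d. positive random variables, independent of the sequence $\{\Theta_t\}$, such that $X_1$ does not have a regularly varying tail (of any index), but $X_{(\infty)}=\sum_{t=1}^\infty \Theta_t X_t$ is finite almost surely and has regularly varying tail of index $-\alpha$. Here a random variable $Y$ has regularly varying tail of index $r\in\mathbb R$ if $\mathbb P[Y>x]>0$ for all $x$ and $\mathbb P[Y>tx]/\mathbb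 P[Y>x]\to t^{r}$ as $x\to\infty$ for every $t>0$. -/

import Mathlib

open MeasureTheory ProbabilityTheory Filter
open scoped Topology ENNReal

universe u

namespace RandWeighted

/-- `f` is regularly varying (at infinity) of index `r`: it is eventually positive and
`f (t * x) / f x → t ^ r` as `x → ∞`, for every `t > 0`. -/
def IsRegularlyVarying (f : ℝ → ℝ) (r : ℝ) : Prop :=
  (∀ᶠ x in atTop, 0 < f x) ∧
    ∀ t : ℝ, 0 < t → Tendsto (fun x : ℝ => f (t * x) / f x) atTop (𝓝 (t ^ r))

/-- The random variable `X` has regularly varying tail of index `r`: its tail probability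
`x ↦ P[X > x]` is regularly varying of index `r`. -/
def HasRVTail {Ω : Type*} [MeasurableSpace Ω] (P : Measure Ω) (X : Ω → ℝ) (r : ℝ) : Prop :=
  IsRegularlyVarying (fun x : ℝ => P.real {ω | x < X ω}) r

/-- `E[Θ ^ (α + ε) + Θ ^ (α - ε)]`, as an extended nonnegative number. -/
noncomputable def rwMoment {Ω : Type*} [MeasurableSpace Ω] (P : Measure Ω) (Θ : Ω → ℝ)
    (α ε : ℝ) : ℝ≥0∞ :=
  ∫⁻ ω, ENNReal.ofReal (Θ ω ^ (α + ε) + Θ ω ^ (α - ε)) ∂P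

/-- The Resnick–Willekens moment conditions: for some `ε ∈ (0, α)`,
`∑ E[Θ_t^(α+ε) + Θ_t^(α-ε)] < ∞` if `0 < α < 1`, and
`∑ (E[Θ_t^(α+ε) + Θ_t^(α-ε)])^(1/(α+ε)) < ∞` if `1 ≤ α`. -/
def RWCondition {Ω : Type*} [MeasurableSpace Ω] (P : Measure Ω) (Θ : ℕ → Ω → ℝ)
    (α : ℝ) : Prop :=
  (0 < α ∧ α < 1 ∧ ∃ ε : ℝ, 0 < ε ∧ ε < α ∧ ∑' t, rwMoment P (Θ t) α ε < ∞) ∨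
  (1 ≤ α ∧ ∃ ε : ℝ, 0 < ε ∧ ε < α ∧ ∑' t, (rwMoment P (Θ t) α ε) ^ (1 / (α + ε)) < ∞)

end RandWeighted

/-! Take `X_t = exp U_t`, where `U_t` has tail `min 1 (exp (-α u) (1 + a cos (β₀ u)))` for a small
`a > 0`. The tail of `X_t` is eventually `x ^ (-α)` times a factor periodic and nonconstant in `log
x`, so it is not regularly varying.

Conditioning on the weight, `P[Θ_t X_t > x]` is close to `x ^ (-α) E[Θ_t ^ α (1 + a cos (β₀ (log x -
log Θ_t)))]`. Its oscillating part is `a x ^ (-α)` times the real part of `x ^ (-iβ₀) E[Θ_t ^ (α +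
iβ₀)]`. The factor `x ^ (-iβ₀)` does not depend on `t`, so summing over `t` kills this part, and the
tails add up to `K x ^ (-α)` asymptotically, with `K = ∑ E[Θ_t ^ α] > 0`
(`tendsto_rpow_mul_tsum_integral_min_modExp`).

It remains to see that the tail of the sum is equivalent to the sum of the tails
(`tendsto_rpow_mul_measureReal_lt_tsum`). Two terms are rarely large together because `X_s` and
`X_t` are independent given the weights, however dependent those are. The terms beyond `n` are
negligible uniformly in `x` by `measure_lt_tsum_ofReal_le`, which applies Minkowski's inequality in
`L^p`, `p > α`, to truncated terms. -/

namespace RandWeighted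

/-! ### Tail bounds for sums of dependent variables with power tails. -/

section PowerTails

variable {Ω : Type*} [MeasurableSpace Ω] {P : Measure Ω}

/-- The truncated `p`-th moment of a nonnegative variable with a tail bounded by a power
`z ^ (-α)`, `α < p`. -/
theorem lintegral_min_rpow_le {Z : Ω → ℝ} (hZ : Measurable Z) (hZ0 : ∀ ω, 0 ≤ Z ω)
    {α p c x : ℝ} (hc : 0 ≤ c) (hp : 0 < p) (hαp : α < p) (hx : 0 < x)
    (htail : ∀ z, 0 < z → P {ω | z < Z ω} ≤ ENNReal.ofReal (c * z ^ (-α))) :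
    ∫⁻ ω, ENNReal.ofReal (min (Z ω) x ^ p) ∂P ≤
      ENNReal.ofReal (p / (p - α) * c * x ^ (p - α)) := by
  rw [lintegral_rpow_eq_lintegral_meas_lt_mul P
    (Eventually.of_forall fun ω => le_min (hZ0 ω) hx.le)
    (hZ.min measurable_const).aemeasurable hp]
  have hint : IntervalIntegrable (fun t : ℝ => t ^ (p - α - 1)) volume 0 x :=
    intervalIntegral.intervalIntegrable_rpow' (by linarith)
  have hval : ∫ t in (0 : ℝ)..x, t ^ (p - α - 1) = x ^ (p - α) / (p - α) := by
    rw [integral_rpow (Or.inl (by linarith))]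
    simp [Real.zero_rpow (sub_pos.2 hαp).ne']
  have hbound : ∫⁻ t in Set.Ioi (0 : ℝ), P {ω | t < min (Z ω) x} * ENNReal.ofReal (t ^ (p - 1)) ≤
      ∫⁻ t in Set.Ioc (0 : ℝ) x, ENNReal.ofReal (c * t ^ (p - α - 1)) := by
    rw [← lintegral_indicator measurableSet_Ioi, ← lintegral_indicator measurableSet_Ioc]
    refine lintegral_mono fun t => ?_
    by_cases ht : 0 < t
    · by_cases htx : t ≤ x
      · rw [Set.indicator_of_mem (show t ∈ Set.Ioi 0 from ht),
          Set.indicator_of_mem (show t ∈ Set.Ioc 0 x from ⟨ht, htx⟩)]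
        calc P {ω | t < min (Z ω) x} * ENNReal.ofReal (t ^ (p - 1))
            ≤ ENNReal.ofReal (c * t ^ (-α)) * ENNReal.ofReal (t ^ (p - 1)) := by
              gcongr
              exact (measure_mono fun ω (hω : t < min (Z ω) x) => (lt_min_iff.1 hω).1).trans
                (htail t ht)
          _ = ENNReal.ofReal (c * t ^ (p - α - 1)) := by
              rw [← ENNReal.ofReal_mul (by positivity), mul_assoc, ← Real.rpow_add ht]
              ring_nf
      · have : {ω | t < min (Z ω) x} = ∅ :=
          Set.eq_empty_of_forall_notMem fun ω (h : t < min (Z ω) x) => htx (lt_min_iff.1 h).2.le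
        rw [Set.indicator_of_mem (show t ∈ Set.Ioi 0 from ht), this]
        simp
    · simp [Set.indicator, ht]
  calc ENNReal.ofReal p *
        ∫⁻ t in Set.Ioi (0 : ℝ), P {ω | t < min (Z ω) x} * ENNReal.ofReal (t ^ (p - 1))
      ≤ ENNReal.ofReal p * ∫⁻ t in Set.Ioc (0 : ℝ) x, ENNReal.ofReal (c * t ^ (p - α - 1)) := by
        gcongr
    _ = ENNReal.ofReal p * ENNReal.ofReal (c * (x ^ (p - α) / (p - α))) := by
        rw [← ofReal_integral_eq_lintegral_ofReal, integral_const_mul,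
          ← intervalIntegral.integral_of_le hx.le, hval]
        · exact ((intervalIntegrable_iff_integrableOn_Ioc_of_le hx.le).1 hint).const_mul c
        · filter_upwards [ae_restrict_mem measurableSet_Ioc] with t ht
          have := ht.1
          positivity
    _ = ENNReal.ofReal (p / (p - α) * c * x ^ (p - α)) := by
        rw [← ENNReal.ofReal_mul hp.le]
        ring_nf

/-- The factor `c ^ (1 / p)` is kept apart because Minkowski's inequality will sum exactly these
factors. -/
theorem eLpNorm_min_le {Z : Ω → ℝ} (hZ : Measurable Z) (hZ0 : ∀ ω, 0 ≤ Z ω)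
    {α p c x : ℝ} (hc : 0 ≤ c) (hp : 0 < p) (hαp : α < p) (hx : 0 < x)
    (htail : ∀ z, 0 < z → P {ω | z < Z ω} ≤ ENNReal.ofReal (c * z ^ (-α))) :
    eLpNorm (fun ω => min (Z ω) x) (ENNReal.ofReal p) P ≤
      ENNReal.ofReal ((p / (p - α)  * x ^ (p - α)) ^ (1 / p) * c ^ (1 / p)) := by
  have hD : 0 ≤ p / (p - α) := div_nonneg hp.le (sub_pos.2 hαp).le
  rw [eLpNorm_eq_lintegral_rpow_enorm_toReal (by simpa using hp) ENNReal.ofReal_ne_top,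
    ENNReal.toReal_ofReal hp.le]
  calc (∫⁻ ω, ‖min (Z ω) x‖ₑ ^ p ∂P) ^ (1 / p)
      = (∫⁻ ω, ENNReal.ofReal (min (Z ω) x ^ p) ∂P) ^ (1 / p) := by
        congr 2 with ω
        have h0 := le_min (hZ0 ω) hx.le
        rw [Real.enorm_of_nonneg h0, ENNReal.ofReal_rpow_of_nonneg h0 hp.le]
    _ ≤ (ENNReal.ofReal (p / (p - α) * c * x ^ (p - α))) ^ (1 / p) := by
        gcongr
        exact lintegral_min_rpow_le hZ hZ0 hc hp hαp hx htail
    _ = _ := by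
        rw [ENNReal.ofReal_rpow_of_nonneg (by positivity) (by positivity),
          ← Real.mul_rpow (by positivity) hc]
        ring_nf

/-- The tail of a finite sum of (arbitrarily dependent) nonnegative variables with power tails. -/
theorem measure_lt_finset_sum_le {ι : Type*} {Z : ι → Ω → ℝ} (hZ : ∀ t, Measurable (Z t))
    (hZ0 : ∀ t ω, 0 ≤ Z t ω) {α p x : ℝ} {c : ι → ℝ} (hc : ∀ t, 0 ≤ c t) (hp : 1 ≤ p)
    (hαp : α < p) (hx : 0 < x)
    (htail : ∀ t z, 0 < z → P {ω | z < Z t ω} ≤ ENNReal.ofReal (c t * z ^ (-α)))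
    (s : Finset ι) :
    P {ω | x < ∑ t ∈ s, Z t ω} ≤
      ENNReal.ofReal (p / (p - α) * x ^ (-α) * (∑ t ∈ s, c t ^ (1 / p)) ^ p) := by
  have hp0 : 0 < p := by linarith
  have hD : 0 ≤ p / (p - α) := div_nonneg hp0.le (sub_pos.2 hαp).le
  have hc' : ∀ t, 0 ≤ c t ^ (1 / p) := fun t => Real.rpow_nonneg (hc t) _
  have hS : 0 ≤ ∑ t ∈ s, c t ^ (1 / p) := Finset.sum_nonneg fun t _ => hc' t
  set f : Ω → ℝ := ∑ t ∈ s, fun ω => min (Z t ω) x with hf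
  have hfm : Measurable f := by
    rw [hf, Finset.sum_fn]
    exact Finset.measurable_sum _ fun t _ => (hZ t).min measurable_const
  have hnorm : eLpNorm f (ENNReal.ofReal p) P ≤
      ENNReal.ofReal ((p / (p - α) * x ^ (p - α)) ^ (1 / p) * ∑ t ∈ s, c t ^ (1 / p)) := by
    refine (eLpNorm_sum_le (fun t _ => ((hZ t).min measurable_const).aestronglyMeasurable)
      (by simpa using hp)).trans ?_
    rw [Finset.mul_sum, ENNReal.ofReal_sum_of_nonneg fun t _ => mul_nonneg (by positivity) (hc' t)]
    exact Finset.sum_le_sum fun t _ => eLpNorm_min_le (hZ t) (hZ0 t) (hc t) hp0 hαp hx (htail t)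
  -- Truncating at the level `x` itself loses nothing: a summand above `x` still contributes `x`,
  -- and if there is none the sum is unchanged.
  have hsub : {ω | x < ∑ t ∈ s, Z t ω} ⊆ {ω | ENNReal.ofReal x ≤ ‖f ω‖ₑ} := by
    intro ω (hω : x < _)
    have hle : x ≤ f ω := by
      rw [hf, Finset.sum_apply]
      by_cases h : ∃ t ∈ s, x < Z t ω
      · obtain ⟨t, ht, htx⟩ := h
        calc x = min (Z t ω) x := (min_eq_right htx.le).symm
          _ ≤ _ := Finset.single_le_sum (f := fun t => min (Z t ω) x)
            (fun t _ => le_min (hZ0 t ω) hx.le) ht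
      · push Not at h
        rw [Finset.sum_congr rfl fun t ht => min_eq_left (h t ht)]
        exact hω.le
    change ENNReal.ofReal x ≤ ‖f ω‖ₑ
    rw [Real.enorm_of_nonneg (hx.le.trans hle)]
    exact ENNReal.ofReal_le_ofReal hle
  refine (measure_mono hsub).trans ((meas_ge_le_mul_pow_eLpNorm_enorm P (by simpa using hp0)
    ENNReal.ofReal_ne_top hfm.aestronglyMeasurable (by simpa using hx) (by simp)).trans ?_)
  rw [ENNReal.toReal_ofReal hp0.le]
  calc (ENNReal.ofReal x)⁻¹ ^ p * eLpNorm f (ENNReal.ofReal p) P ^ p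
      ≤ (ENNReal.ofReal x)⁻¹ ^ p * ENNReal.ofReal
          ((p / (p - α) * x ^ (p - α)) ^ (1 / p) * ∑ t ∈ s, c t ^ (1 / p)) ^ p := by gcongr
    _ = _ := by
        rw [← ENNReal.ofReal_inv_of_pos hx, ENNReal.ofReal_rpow_of_nonneg (by positivity) hp0.le,
          ENNReal.ofReal_rpow_of_nonneg (by positivity) hp0.le,
          ← ENNReal.ofReal_mul (by positivity), Real.mul_rpow (by positivity) hS,
          ← Real.rpow_mul (by positivity), one_div_mul_cancel hp0.ne', Real.rpow_one,
          Real.inv_rpow hx.le, ← Real.rpow_neg hx.le, ← mul_assoc, ← mul_assoc,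
          mul_comm (x ^ (-p)), mul_assoc (p / (p - α)), ← Real.rpow_add hx]
        ring_nf

/-- The tail of an infinite sum of (arbitrarily dependent) nonnegative variables with power
tails. -/
theorem measure_lt_tsum_ofReal_le {Z : ℕ → Ω → ℝ} (hZ : ∀ t, Measurable (Z t))
    (hZ0 : ∀ t ω, 0 ≤ Z t ω) {α p x : ℝ} {c : ℕ → ℝ} (hc : ∀ t, 0 ≤ c t) (hp : 1 ≤ p)
    (hαp : α < p) (hx : 0 < x)
    (htail : ∀ t z, 0 < z → P {ω | z < Z t ω} ≤ ENNReal.ofReal (c t * z ^ (-α)))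
    (hsum : Summable fun t => c t ^ (1 / p)) :
    P {ω | ENNReal.ofReal x < ∑' t, ENNReal.ofReal (Z t ω)} ≤
      ENNReal.ofReal (p / (p - α) * x ^ (-α) * (∑' t, c t ^ (1 / p)) ^ p) := by
  have hp0 : 0 < p := by linarith
  have hD : 0 ≤ p / (p - α) := div_nonneg hp0.le (sub_pos.2 hαp).le
  have hc' : ∀ t, 0 ≤ c t ^ (1 / p) := fun t => Real.rpow_nonneg (hc t) _
  have heq : {ω | ENNReal.ofReal x < ∑' t, ENNReal.ofReal (Z t ω)} =
      ⋃ n : ℕ, {ω | x < ∑ t ∈ Finset.range n, Z t ω} := by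
    ext ω
    rw [Set.mem_ofPred_eq, ENNReal.tsum_eq_iSup_nat, lt_iSup_iff, Set.mem_iUnion]
    refine exists_congr fun n => ?_
    rw [← ENNReal.ofReal_sum_of_nonneg fun t _ => hZ0 t ω, ENNReal.ofReal_lt_ofReal_iff_of_nonneg
      hx.le, Set.mem_ofPred_eq]
  have hmono : Monotone fun n : ℕ => {ω | x < ∑ t ∈ Finset.range n, Z t ω} := by
    intro m n hmn ω (hω : x < _)
    exact hω.trans_le (Finset.sum_le_sum_of_subset_of_nonneg (Finset.range_mono hmn)
      fun t _ _ => hZ0 t ω)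
  rw [heq, hmono.measure_iUnion]
  refine iSup_le fun n => (measure_lt_finset_sum_le hZ hZ0 hc hp hαp hx htail _).trans ?_
  apply ENNReal.ofReal_le_ofReal
  gcongr
  · exact Finset.sum_nonneg fun t _ => hc' t
  · exact hsum.sum_le_tsum _ fun t _ => hc' t

/-- The tail bound for the series, taken in `[0, ∞]`, tends to `0` as `x → ∞`, so the value `∞` has
probability zero. -/
theorem ae_summable_of_power_tails {Z : ℕ → Ω → ℝ} (hZ : ∀ t, Measurable (Z t))
    (hZ0 : ∀ t ω, 0 ≤ Z t ω) {α p : ℝ} {c : ℕ → ℝ} (hc : ∀ t, 0 ≤ c t) (hp : 1 ≤ p)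
    (hα : 0 < α) (hαp : α < p)
    (htail : ∀ t z, 0 < z → P {ω | z < Z t ω} ≤ ENNReal.ofReal (c t * z ^ (-α)))
    (hsum : Summable fun t => c t ^ (1 / p)) :
    ∀ᵐ ω ∂P, Summable fun t => Z t ω := by
  have hzero : P {ω | ∑' t, ENNReal.ofReal (Z t ω) = ∞} = 0 := by
    have hlim : Tendsto (fun x : ℝ => ENNReal.ofReal
        (p / (p - α) * x ^ (-α) * (∑' t, c t ^ (1 / p)) ^ p)) atTop (𝓝 0) := by
      rw [← ENNReal.ofReal_zero]
      apply ENNReal.tendsto_ofReal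
      have := ((tendsto_rpow_neg_atTop hα).const_mul (p / (p - α))).mul_const
        ((∑' t, c t ^ (1 / p)) ^ p)
      simpa using this
    refine le_antisymm (ge_of_tendsto hlim ?_) zero_le
    filter_upwards [eventually_gt_atTop 0] with x hx
    refine (measure_mono ?_).trans (measure_lt_tsum_ofReal_le hZ hZ0 hc hp hαp hx htail hsum)
    intro ω (hω : _ = ∞)
    change ENNReal.ofReal x < _
    rw [hω]
    exact ENNReal.ofReal_lt_top
  have : ∀ᵐ ω ∂P, ∑' t, ENNReal.ofReal (Z t ω) ≠ ∞ := by
    rw [ae_iff]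
    simpa using hzero
  filter_upwards [this] with ω hω
  have := ENNReal.summable_toReal hω
  simpa [ENNReal.toReal_ofReal (hZ0 _ ω)] using this

end PowerTails

/-! ### The principle of one big jump. -/

section BigJump

/-- If a sum is large, then one summand is almost as large, or two summands are fairly large. -/
theorem exists_lt_or_exists_pair_lt {z : ℕ → ℝ} {n : ℕ} {y δ : ℝ} (hy : 0 < y) (hδ : 0 < δ)
    (hδ1 : δ < 1) (h : y < ∑ t ∈ Finset.range n, z t) :
    (∃ t ∈ Finset.range n, (1 - δ) * y < z t) ∨
      ∃ t ∈ Finset.range n, ∃ s ∈ Finset.range t, δ / (n + 1) * y < z s ∧ δ / (n + 1) * y < z t := by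
  by_contra! hcon
  obtain ⟨h1, h2⟩ := hcon
  -- With this threshold `n * e < δ * y`: if at most one summand exceeds `e`, the others together
  -- leave more than `(1 - δ) * y` to it.
  set e := δ / (n + 1) * y with he
  have he0 : 0 < e := by positivity
  have hne : n * e < δ * y := by
    have : (n + 1) * e = δ * y := by rw [he]; field_simp
    linarith
  have hδy : 0 < (1 - δ) * y := mul_pos (by linarith) hy
  by_cases hbig : ∃ t ∈ Finset.range n, e < z t
  · obtain ⟨t, ht, htz⟩ := hbig
    have hother : ∀ s ∈ (Finset.range n).erase t, z s ≤ e := by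
      intro s hs
      obtain ⟨hst, hsn⟩ := Finset.mem_erase.1 hs
      rcases lt_or_gt_of_ne hst with hlt | hgt
      · by_contra! hc
        exact absurd (h2 t ht s (Finset.mem_range.2 hlt) hc) (not_le.2 htz)
      · exact h2 s hsn t (Finset.mem_range.2 hgt) htz
    have hsum := Finset.sum_le_card_nsmul _ _ _ hother
    have hcard : (((Finset.range n).erase t).card : ℝ) ≤ n := by
      exact_mod_cast (Finset.card_le_card (Finset.erase_subset t _)).trans_eq (Finset.card_range n)
    rw [nsmul_eq_mul] at hsum
    have := mul_le_mul_of_nonneg_right hcard he0.le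
    have h1t := h1 t ht
    rw [← Finset.add_sum_erase _ _ ht] at h
    linarith
  · push Not at hbig
    have hsum := Finset.sum_le_card_nsmul _ _ _ hbig
    rw [nsmul_eq_mul, Finset.card_range] at hsum
    linarith

theorem tendsto_rpow_mul_comp_mul {g : ℝ → ℝ} {α L κ : ℝ} (hκ : 0 < κ)
    (hg : Tendsto (fun x => x ^ α * g x) atTop (𝓝 L)) :
    Tendsto (fun x => x ^ α * g (κ * x)) atTop (𝓝 (κ ^ (-α) * L)) := by
  refine ((hg.comp (tendsto_id.const_mul_atTop hκ)).const_mul (κ ^ (-α))).congr' ?_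
  filter_upwards [eventually_gt_atTop 0] with x hx
  simp only [Function.comp, id]
  rw [Real.mul_rpow hκ.le hx.le, ← mul_assoc, ← mul_assoc, ← Real.rpow_add hκ]
  simp

/-- Eventually `c t ^ (1 / p) ≤ 1`, and raising such a number to the power `p ≥ 1` only decreases
it. -/
theorem summable_of_summable_rpow_one_div {c : ℕ → ℝ} (hc : ∀ t, 0 ≤ c t) {p : ℝ} (hp : 1 ≤ p)
    (h : Summable fun t => c t ^ (1 / p)) : Summable c := by
  have hp0 : 0 < p := by linarith
  refine summable_of_isBigO_nat h (Asymptotics.IsBigO.of_bound 1 ?_)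
  filter_upwards [h.tendsto_atTop_zero.eventually_le_const one_pos] with t ht
  have h0 : 0 ≤ c t ^ (1 / p) := Real.rpow_nonneg (hc t) _
  rw [Real.norm_of_nonneg (hc t), Real.norm_of_nonneg h0, one_mul]
  calc c t = (c t ^ (1 / p)) ^ p := by
        rw [← Real.rpow_mul (hc t), one_div_mul_cancel hp0.ne', Real.rpow_one]
    _ ≤ (c t ^ (1 / p)) ^ (1 : ℝ) := Real.rpow_le_rpow_of_exponent_ge' h0 ht zero_le_one hp
    _ = c t ^ (1 / p) := Real.rpow_one _

variable {Ω : Type*} [MeasurableSpace Ω] {P : Measure Ω}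

/-- The second Bonferroni inequality. -/
theorem sum_measureReal_le [IsFiniteMeasure P] {A : ℕ → Set Ω} (hA : ∀ t, MeasurableSet (A t))
    (n : ℕ) :
    ∑ t ∈ Finset.range n, P.real (A t) ≤ P.real (⋃ t ∈ Finset.range n, A t) +
      ∑ t ∈ Finset.range n, ∑ s ∈ Finset.range t, P.real (A s ∩ A t) := by
  induction n with
  | zero => simp
  | succ n ih =>
    have hun : ⋃ t ∈ Finset.range (n + 1), A t = (⋃ t ∈ Finset.range n, A t) ∪ A n := by
      rw [Finset.range_add_one, Finset.set_biUnion_insert, Set.union_comm]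
    have hinter : P.real ((⋃ t ∈ Finset.range n, A t) ∩ A n) ≤
        ∑ s ∈ Finset.range n, P.real (A s ∩ A n) := by
      rw [Set.iUnion₂_inter]
      exact measureReal_biUnion_finset_le _ _
    have := measureReal_union_add_inter (μ := P) (s := ⋃ t ∈ Finset.range n, A t) (hA n)
      (measure_ne_top _ _) (measure_ne_top _ _)
    rw [Finset.sum_range_succ, Finset.sum_range_succ, hun]
    linarith

/-- The principle of one big jump: for nonnegative variables with summable power tails, no two of
which are likely to be large together, the tail of the sum is equivalent to the sum of the
tails. -/
theorem tendsto_rpow_mul_measureReal_lt_tsum [IsProbabilityMeasure P] {Z : ℕ → Ω → ℝ}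
    (hZ : ∀ t, Measurable (Z t)) (hZ0 : ∀ t ω, 0 ≤ Z t ω) {α p K : ℝ} {c : ℕ → ℝ}
    (hc : ∀ t, 0 ≤ c t) (hp : 1 ≤ p) (hα : 0 < α) (hαp : α < p)
    (htail : ∀ t z, 0 < z → P {ω | z < Z t ω} ≤ ENNReal.ofReal (c t * z ^ (-α)))
    (hsum : Summable fun t => c t ^ (1 / p))
    (hpair : ∀ s t, s ≠ t →
      Tendsto (fun x : ℝ => x ^ α * P.real {ω | x < Z s ω ∧ x < Z t ω}) atTop (𝓝 0))
    (hK : Tendsto (fun x : ℝ => x ^ α * ∑' t, P.real {ω | x < Z t ω}) atTop (𝓝 K)) :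
    Tendsto (fun x : ℝ => x ^ α * P.real {ω | x < ∑' t, Z t ω}) atTop (𝓝 K) := by
  have hp0 : 0 < p := by linarith
  have hD : 0 ≤ p / (p - α) := div_nonneg hp0.le (sub_pos.2 hαp).le
  have hc' : ∀ t, 0 ≤ c t ^ (1 / p) := fun t => Real.rpow_nonneg (hc t) _
  have hcs := summable_of_summable_rpow_one_div hc hp hsum
  have htail' : ∀ t z, 0 < z → P.real {ω | z < Z t ω} ≤ c t * z ^ (-α) := fun t z hz =>
    ENNReal.toReal_le_of_le_ofReal (mul_nonneg (hc t) (by positivity)) (htail t z hz)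
  have htsum : ∀ z, 0 < z → Summable fun t => P.real {ω | z < Z t ω} := fun z hz =>
    Summable.of_nonneg_of_le (fun t => measureReal_nonneg) (fun t => htail' t z hz)
      (hcs.mul_right _)
  have hZs := ae_summable_of_power_tails hZ hZ0 hc hp hα hαp htail hsum
  set B : ℕ → ℝ → ℝ := fun n x =>
    ∑ t ∈ Finset.range n, ∑ s ∈ Finset.range t, P.real {ω | x < Z s ω ∧ x < Z t ω} with hB
  have hBlim : ∀ n, Tendsto (fun x => x ^ α * B n x) atTop (𝓝 0) := by
    intro n
    simp only [hB, Finset.mul_sum]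
    rw [show (0 : ℝ) = ∑ t ∈ Finset.range n, ∑ s ∈ Finset.range t, (0 : ℝ) by simp]
    exact tendsto_finsetSum _ fun t _ => tendsto_finsetSum _ fun s hs =>
      hpair s t (Finset.mem_range.1 hs).ne
  set R : ℕ → ℝ := fun n => ∑' t, c (t + n) ^ (1 / p) with hR
  have hRlim : Tendsto R atTop (𝓝 0) := tendsto_sum_nat_add fun t => c t ^ (1 / p)
  have hR0 : ∀ n, 0 ≤ R n := fun n => tsum_nonneg fun t => hc' _
  -- Either the terms from `n` on exceed `δ * x`, or the first `n` exceed `(1 - δ) * x`; splitting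
  -- the latter case into one large or two fairly large summands costs the second factor `1 - δ`.
  have hupper : ∀ n (δ x : ℝ), 0 < δ → δ < 1 → 0 < x →
      P.real {ω | x < ∑' t, Z t ω} ≤ ∑' t, P.real {ω | (1 - δ) * (1 - δ) * x < Z t ω} +
        B n (δ / (n + 1) * (1 - δ) * x) + p / (p - α) * (δ * x) ^ (-α) * R n ^ p := by
    intro n δ x hδ hδ1 hx
    have hy : 0 < (1 - δ) * x := mul_pos (by linarith) hx
    set E₁ : Set Ω := ⋃ t ∈ Finset.range n, {ω | (1 - δ) * (1 - δ) * x < Z t ω} with hE₁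
    set E₂ : Set Ω := ⋃ t ∈ Finset.range n, ⋃ s ∈ Finset.range t,
      {ω | δ / (n + 1) * (1 - δ) * x < Z s ω ∧ δ / (n + 1) * (1 - δ) * x < Z t ω} with hE₂
    set E₃ : Set Ω := {ω | ENNReal.ofReal (δ * x) < ∑' t, ENNReal.ofReal (Z (t + n) ω)} with hE₃
    have hsub : {ω | x < ∑' t, Z t ω} ≤ᵐ[P] (E₁ ∪ E₂ ∪ E₃ : Set Ω) := by
      filter_upwards [hZs] with ω hω (hxω : x < ∑' t, Z t ω)
      change ω ∈ E₁ ∪ E₂ ∪ E₃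
      by_cases h3 : ω ∈ E₃
      · exact Or.inr h3
      have hle : ∑' t, Z (t + n) ω ≤ δ * x := by
        by_contra! hlt
        refine h3 (show ENNReal.ofReal (δ * x) < _ from ?_)
        rw [← ENNReal.ofReal_tsum_of_nonneg (fun t => hZ0 _ ω) ((summable_nat_add_iff n).2 hω)]
        exact (ENNReal.ofReal_lt_ofReal_iff_of_nonneg (by positivity)).2 hlt
      have hlt : (1 - δ) * x < ∑ t ∈ Finset.range n, Z t ω := by
        have := hω.sum_add_tsum_nat_add n
        linarith
      left
      rcases exists_lt_or_exists_pair_lt hy hδ hδ1 hlt with ⟨t, ht, h⟩ | ⟨t, ht, s, hs, h⟩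
      · left
        simp only [hE₁, Set.mem_iUnion]
        exact ⟨t, ht, by rw [← mul_assoc] at h; exact h⟩
      · right
        simp only [hE₂, Set.mem_iUnion]
        exact ⟨t, ht, s, hs, by rw [← mul_assoc] at h; exact h⟩
    have h1 : P.real E₁ ≤ ∑' t, P.real {ω | (1 - δ) * (1 - δ) * x < Z t ω} :=
      (measureReal_biUnion_finset_le _ _).trans
        ((htsum _ (by rw [mul_assoc]; exact mul_pos (by linarith) hy)).sum_le_tsum _
          fun t _ => measureReal_nonneg)
    have h2 : P.real E₂ ≤ B n (δ / (n + 1) * (1 - δ) * x) :=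
      (measureReal_biUnion_finset_le _ _).trans
        (Finset.sum_le_sum fun t _ => measureReal_biUnion_finset_le _ _)
    have h3 : P.real E₃ ≤ p / (p - α) * (δ * x) ^ (-α) * R n ^ p :=
      ENNReal.toReal_le_of_le_ofReal
        (mul_nonneg (mul_nonneg hD (by positivity)) (Real.rpow_nonneg (hR0 n) _))
        (measure_lt_tsum_ofReal_le (fun t => hZ (t + n)) (fun t => hZ0 (t + n))
          (fun t => hc (t + n)) hp hαp (by positivity) (fun t => htail (t + n))
          ((summable_nat_add_iff n).2 hsum))
    calc P.real {ω | x < ∑' t, Z t ω} ≤ P.real (E₁ ∪ E₂ ∪ E₃) :=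
          ENNReal.toReal_mono (measure_ne_top _ _) (measure_mono_ae hsub)
      _ ≤ P.real E₁ + P.real E₂ + P.real E₃ :=
          (measureReal_union_le _ _).trans (by gcongr; exact measureReal_union_le _ _)
      _ ≤ _ := by gcongr
  -- One large term already makes the sum large. Bonferroni handles the first `n` terms, and the
  -- tails left out total at most `x ^ (-α) * ∑' t, c (t + n)`.
  have hlower : ∀ n (x : ℝ), 0 < x →
      ∑' t, P.real {ω | x < Z t ω} - x ^ (-α) * ∑' t, c (t + n) - B n x ≤
        P.real {ω | x < ∑' t, Z t ω} := by
    intro n x hx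
    have hbon := sum_measureReal_le (P := P) (A := fun t => {ω | x < Z t ω})
      (fun t => measurableSet_lt measurable_const (hZ t)) n
    have hun : P.real (⋃ t ∈ Finset.range n, {ω | x < Z t ω}) ≤ P.real {ω | x < ∑' t, Z t ω} := by
      refine ENNReal.toReal_mono (measure_ne_top _ _) (measure_mono_ae ?_)
      filter_upwards [hZs] with ω hω (h : ω ∈ ⋃ t ∈ Finset.range n, {ω | x < Z t ω})
      simp only [Set.mem_iUnion] at h
      obtain ⟨t, _, ht⟩ := h
      exact lt_of_lt_of_le ht (hω.le_tsum t fun s _ => hZ0 s ω)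
    have hsplit := (htsum x hx).sum_add_tsum_nat_add n
    have hrest : ∑' t, P.real {ω | x < Z (t + n) ω} ≤ x ^ (-α) * ∑' t, c (t + n) := by
      rw [← tsum_mul_left]
      refine ((summable_nat_add_iff n).2 (htsum x hx)).tsum_le_tsum (fun t => ?_)
        (((summable_nat_add_iff n).2 hcs).mul_left _)
      rw [mul_comm]
      exact htail' _ x hx
    have hBx : B n x = ∑ t ∈ Finset.range n, ∑ s ∈ Finset.range t,
        P.real ({ω | x < Z s ω} ∩ {ω | x < Z t ω}) := rfl
    linarith
  rw [tendsto_order]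
  constructor
  · intro a ha
    have hlim : Tendsto (fun n => K - ∑' t, c (t + n) - 0) atTop (𝓝 (K - 0 - 0)) :=
      (tendsto_const_nhds.sub (tendsto_sum_nat_add c)).sub tendsto_const_nhds
    obtain ⟨n, hn⟩ := (hlim.eventually_const_lt (by simpa using ha)).exists
    have hx := (hK.sub (tendsto_const_nhds (x := ∑' t, c (t + n)))).sub (hBlim n)
    filter_upwards [hx.eventually_const_lt hn, eventually_gt_atTop 0] with x hx hx0
    refine hx.trans_le ?_
    refine le_trans (le_of_eq ?_)
      (mul_le_mul_of_nonneg_left (hlower n x hx0) (Real.rpow_nonneg hx0.le α))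
    rw [mul_sub, mul_sub, ← mul_assoc (x ^ α) (x ^ (-α)), ← Real.rpow_add hx0]
    simp
  · intro b hb
    -- The order of choices matters: `δ` first, then `n` making the remainder small against `δ ^
    -- (-α)`, then `x` large for these two.
    have hδlim : Tendsto (fun δ : ℝ => ((1 - δ) * (1 - δ)) ^ (-α) * K) (𝓝[>] 0) (𝓝 K) := by
      have : ContinuousAt (fun δ : ℝ => ((1 - δ) * (1 - δ)) ^ (-α) * K) 0 := by
        refine ContinuousAt.mul (ContinuousAt.rpow (by fun_prop) continuousAt_const ?_)
          continuousAt_const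
        left
        norm_num
      have := this.tendsto
      simp only [sub_zero, mul_one, Real.one_rpow, one_mul] at this
      exact this.mono_left nhdsWithin_le_nhds
    obtain ⟨δ, hδb, hδ1, hδ⟩ := ((hδlim.eventually_lt_const hb).and
      (Ioo_mem_nhdsGT (zero_lt_one' ℝ) |> fun h => (eventually_of_mem h fun δ hδ => ⟨hδ.2, hδ.1⟩ :
        ∀ᶠ δ : ℝ in 𝓝[>] 0, δ < 1 ∧ 0 < δ))).exists
    have hnlim : Tendsto (fun n => ((1 - δ) * (1 - δ)) ^ (-α) * K +
        (0 : ℝ) + p / (p - α) * δ ^ (-α) * R n ^ p) atTop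
        (𝓝 (((1 - δ) * (1 - δ)) ^ (-α) * K + 0 + p / (p - α) * δ ^ (-α) * 0 ^ p)) :=
      tendsto_const_nhds.add ((hRlim.rpow_const (Or.inr hp0.le)).const_mul _)
    rw [Real.zero_rpow hp0.ne', mul_zero, add_zero, add_zero] at hnlim
    obtain ⟨n, hn⟩ := (hnlim.eventually_lt_const hδb).exists
    have h1δ : 0 < 1 - δ := by linarith
    have hx := ((tendsto_rpow_mul_comp_mul (mul_pos h1δ h1δ) hK).add
      (tendsto_rpow_mul_comp_mul (κ := δ / (n + 1) * (1 - δ)) (by positivity) (hBlim n))).add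
      (tendsto_const_nhds (x := p / (p - α) * δ ^ (-α) * R n ^ p))
    rw [mul_zero, add_zero] at hx
    filter_upwards [hx.eventually_lt_const hn, eventually_gt_atTop 0] with x hx hx0
    refine lt_of_le_of_lt ?_ hx
    refine (mul_le_mul_of_nonneg_left (hupper n δ x hδ hδ1 hx0)
      (Real.rpow_nonneg hx0.le α)).trans (le_of_eq ?_)
    have hxx : x ^ α * x ^ (-α) = 1 := by rw [← Real.rpow_add hx0]; simp
    rw [Real.mul_rpow hδ.le hx0.le]
    linear_combination p / (p - α) * δ ^ (-α) * R n ^ p * hxx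

end BigJump

/-! ### A law with log-periodic tail. -/

section LogPeriodic

/-- The exponential `exp (-α u)` modulated by the oscillating factor `1 + a cos (β u)`. -/
noncomputable def modExp (α a β u : ℝ) : ℝ := Real.exp (-α * u) * (1 + a * Real.cos (β * u))

variable {α a β : ℝ}

theorem continuous_modExp : Continuous (modExp α a β) := by
  unfold modExp
  fun_prop

theorem modFactor_bounds (ha : 0 ≤ a) (v : ℝ) :
    1 - a ≤ 1 + a * Real.cos v ∧ 1 + a * Real.cos v ≤ 1 + a := by
  constructor <;> nlinarith [Real.neg_one_le_cos v, Real.cos_le_one v]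

theorem modExp_pos (ha : 0 ≤ a) (ha1 : a < 1) (u : ℝ) : 0 < modExp α a β u :=
  mul_pos (Real.exp_pos _) (by linarith [(modFactor_bounds ha (β * u)).1])

/-- The derivative is at most `-exp (-α u) (α - a (α + |β|))`. This is what allows the function to
serve as a tail. -/
theorem antitone_modExp (ha : 0 ≤ a) (haβ : a * (α + |β|) ≤ α) (hα : 0 < α) :
    Antitone (modExp α a β) := by
  have hderiv : ∀ u, HasDerivAt (modExp α a β)
      (Real.exp (-α * u) * (-α * (1 + a * Real.cos (β * u)) - a * β * Real.sin (β * u))) u := by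
    intro u
    have h1 : HasDerivAt (fun u : ℝ => Real.exp (-α * u)) (Real.exp (-α * u) * -α) u := by
      simpa using ((hasDerivAt_id u).const_mul (-α)).exp
    have h2 : HasDerivAt (fun u : ℝ => 1 + a * Real.cos (β * u))
        (a * (-Real.sin (β * u) * β)) u := by
      simpa using ((((hasDerivAt_id u).const_mul β).cos).const_mul a).const_add 1
    refine (h1.mul h2).congr_deriv ?_
    ring
  refine antitone_of_hasDerivAt_nonpos hderiv fun u => ?_
  refine mul_nonpos_of_nonneg_of_nonpos (Real.exp_pos _).le ?_
  have hc := (modFactor_bounds ha (β * u)).1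
  have hs : -(|β|) ≤ β * Real.sin (β * u) := by
    refine (neg_abs_le _).trans' (neg_le_neg ?_)
    rw [abs_mul]
    exact mul_le_of_le_one_right (abs_nonneg _) (Real.abs_sin_le_one _)
  nlinarith

theorem modExp_le (ha : 0 ≤ a) (u : ℝ) : modExp α a β u ≤ (1 + a) * Real.exp (-α * u) := by
  rw [mul_comm]
  exact mul_le_mul_of_nonneg_left (modFactor_bounds ha _).2 (Real.exp_pos _).le

theorem tendsto_modExp_atTop (ha : 0 ≤ a) (ha1 : a < 1) (hα : 0 < α) :
    Tendsto (modExp α a β) atTop (𝓝 0) := by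
  have h : Tendsto (fun u => (1 + a) * Real.exp (-α * u)) atTop (𝓝 ((1 + a) * 0)) :=
    (Real.tendsto_exp_atBot.comp
      (tendsto_id.const_mul_atTop_of_neg (neg_lt_zero.2 hα))).const_mul _
  rw [mul_zero] at h
  exact tendsto_of_tendsto_of_tendsto_of_le_of_le tendsto_const_nhds h
    (fun u => (modExp_pos ha ha1 u).le) (modExp_le ha)

theorem tendsto_modExp_atBot (ha : 0 ≤ a) (ha1 : a < 1) (hα : 0 < α) :
    Tendsto (modExp α a β) atBot atTop := by
  have h : Tendsto (fun u => Real.exp (-α * u) * (1 - a)) atBot atTop :=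
    (Real.tendsto_exp_atTop.comp
      (tendsto_id.const_mul_atBot_of_neg (neg_lt_zero.2 hα))).atTop_mul_const (by linarith)
  refine tendsto_atTop_mono (fun u => ?_) h
  exact mul_le_mul_of_nonneg_left (modFactor_bounds ha _).1 (Real.exp_pos _).le

/-- There is a law on `ℝ` with tail `u ↦ min 1 (modExp α a β u)`. -/
theorem exists_measure_Ioi_eq_modExp (ha : 0 ≤ a) (ha1 : a < 1) (hα : 0 < α)
    (haβ : a * (α + |β|) ≤ α) :
    ∃ ν : Measure ℝ, IsProbabilityMeasure ν ∧
      ∀ u, ν (Set.Ioi u) = ENNReal.ofReal (min 1 (modExp α a β u)) := by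
  let F : StieltjesFunction ℝ :=
    { toFun := fun u => 1 - min 1 (modExp α a β u)
      mono' := fun u v huv =>
        sub_le_sub_left (min_le_min_left 1 (antitone_modExp ha haβ hα huv)) 1
      right_continuous' := fun u =>
        (continuous_const.sub
          (continuous_const.min continuous_modExp)).continuousAt.continuousWithinAt }
  have htop : Tendsto F atTop (𝓝 1) := by
    have h := (tendsto_const_nhds (x := (1 : ℝ))).sub ((tendsto_const_nhds (x := (1 : ℝ))).min
      (tendsto_modExp_atTop (β := β) ha ha1 hα))
    simpa using h
  have hbot : Tendsto F atBot (𝓝 0) := by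
    refine tendsto_const_nhds.congr' ?_
    filter_upwards [(tendsto_modExp_atBot (β := β) ha ha1 hα).eventually_ge_atTop 1] with u hu
    change 0 = 1 - min 1 (modExp α a β u)
    rw [min_eq_left hu, sub_self]
  refine ⟨F.measure, F.isProbabilityMeasure hbot htop, fun u => ?_⟩
  rw [F.measure_Ioi htop]
  congr 1
  change 1 - (1 - min 1 (modExp α a β u)) = _
  ring

/-- The log-periodic tail `min 1 (modExp α a β (log x))` is not regularly varying. -/
theorem not_isRegularlyVarying_modExp (ha : 0 < a) (ha1 : a < 1) (hα : 0 < α) (hβ : β ≠ 0)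
    (f : ℝ → ℝ) (hf : ∀ x, 0 < x → f x = min 1 (modExp α a β (Real.log x))) (r : ℝ) :
    ¬ IsRegularlyVarying f r := by
  rintro ⟨-, hrv⟩
  -- Cosine is even, so the frequency may be taken positive; the phase sequences used below then
  -- tend to `+∞`.
  set b := |β| with hb
  have hb0 : 0 < b := abs_pos.2 hβ
  have hmod : ∀ u, modExp α a β u = Real.exp (-α * u) * (1 + a * Real.cos (b * u)) := by
    intro u
    rw [modExp, ← Real.cos_abs (β * u), ← Real.cos_abs (b * u), abs_mul, abs_mul, hb, abs_abs]
  have hlog : ∀ u : ℝ, f (Real.exp u) = min 1 (modExp α a β u) := fun u => by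
    rw [hf _ (Real.exp_pos u), Real.log_exp]
  -- A shift by half a period changes the sign of the cosine, so this ratio is itself a nonconstant
  -- periodic function of `u`, which cannot converge.
  have hlim : Tendsto (fun u => modExp α a β (u + Real.pi / b) / modExp α a β u) atTop
      (𝓝 (Real.exp (Real.pi / b) ^ r)) := by
    refine ((hrv _ (Real.exp_pos (Real.pi / b))).comp Real.tendsto_exp_atTop).congr' ?_
    have hev : ∀ᶠ u in atTop, modExp α a β u ≤ 1 :=
      (tendsto_modExp_atTop ha.le ha1 hα).eventually_le_const one_pos
    filter_upwards [hev, (tendsto_atTop_add_const_right atTop (Real.pi / b) tendsto_id).eventually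
      hev] with u hu hu'
    simp only [Function.comp, id] at hu' ⊢
    rw [← Real.exp_add, add_comm, hlog, hlog, min_eq_right hu, min_eq_right hu']
  set e := Real.exp (-α * (Real.pi / b)) with he
  have hratio : ∀ u, modExp α a β (u + Real.pi / b) / modExp α a β u =
      e * ((1 - a * Real.cos (b * u)) / (1 + a * Real.cos (b * u))) := by
    intro u
    have : b * (u + Real.pi / b) = b * u + Real.pi := by field_simp
    rw [hmod, hmod, this, Real.cos_add_pi, mul_add (-α), Real.exp_add, ← he]
    have h1 := (Real.exp_pos (-α * u)).ne'
    have h2 : 1 + a * Real.cos (b * u) ≠ 0 := by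
      linarith [(modFactor_bounds ha.le (b * u)).1] |> fun (h : 0 < _) => h.ne'
    field_simp
    ring
  have hseq : ∀ c : ℝ, Tendsto (fun n : ℕ => (n * (2 * Real.pi) + c) / b) atTop atTop := by
    intro c
    exact (tendsto_atTop_add_const_right _ c
      ((tendsto_natCast_atTop_atTop (R := ℝ)).atTop_mul_const Real.two_pi_pos)).atTop_div_const hb0
  -- Along points of fixed phase `c` the ratio is constant, hence equal to the limit. The phases `0`
  -- and `π` give `(1 - a) / (1 + a)` and its inverse.
  have hval : ∀ c : ℝ, e * ((1 - a * Real.cos c) / (1 + a * Real.cos c)) =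
      Real.exp (Real.pi / b) ^ r := by
    intro c
    refine tendsto_nhds_unique ?_ (hlim.comp (hseq c))
    refine tendsto_const_nhds.congr fun n => ?_
    have : b * ((n * (2 * Real.pi) + c) / b) = c + n * (2 * Real.pi) := by field_simp; ring
    simp only [Function.comp]
    rw [hratio, this, Real.cos_add_nat_mul_two_pi]
  have h := (hval 0).trans (hval Real.pi).symm
  have he0 : e ≠ 0 := (Real.exp_pos _).ne'
  have h1a : 1 - a ≠ 0 := by linarith [sub_pos.2 ha1] |> fun (h : 0 < 1 - a) => h.ne'
  have h2a : 1 + a ≠ 0 := by positivity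
  rw [Real.cos_zero, Real.cos_pi, mul_right_inj' he0, mul_one, mul_neg_one, sub_neg_eq_add,
    ← sub_eq_add_neg, div_eq_div_iff h2a h1a] at h
  nlinarith

end LogPeriodic

/-- The constant `K` cancels in the ratio; its positivity also gives that of `f` near infinity. -/
theorem isRegularlyVarying_of_tendsto {f : ℝ → ℝ} {α K : ℝ} (hK : 0 < K)
    (h : Tendsto (fun x => x ^ α * f x) atTop (𝓝 K)) : IsRegularlyVarying f (-α) := by
  constructor
  · filter_upwards [h.eventually_const_lt hK, eventually_gt_atTop 0] with x hx hx0
    exact pos_of_mul_pos_right hx (Real.rpow_nonneg hx0.le _)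
  · intro t ht
    have := (tendsto_rpow_mul_comp_mul ht h).div h hK.ne'
    rw [mul_div_cancel_right₀ _ hK.ne'] at this
    refine this.congr' ?_
    filter_upwards [eventually_gt_atTop 0] with x hx
    exact mul_div_mul_left _ _ (Real.rpow_pos_of_pos hx α).ne'

/-! ### Moments of the weights and asymptotics of the weighted tails. -/

section Weights

variable {Ω : Type*} [MeasurableSpace Ω] {P : Measure Ω}

/-- The consequence of the moment conditions that is used: `α`-th moments are finite, and the sum
of their `1 / p`-th powers converges for some `p ≥ 1` with `p > α`. -/
theorem RWCondition.exists_summable {Θ : ℕ → Ω → ℝ} (hΘ : ∀ t, Measurable (Θ t))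
    (hpos : ∀ t ω, 0 < Θ t ω) {α : ℝ} (h : RWCondition P Θ α) :
    ∃ p : ℝ, 1 ≤ p ∧ α < p ∧ (∀ t, Integrable (fun ω => Θ t ω ^ α) P) ∧
      Summable fun t => (∫ ω, Θ t ω ^ α ∂P) ^ (1 / p) := by
  -- Both regimes are unified by `p = 1` when `α < 1` and `p = α + ε` when `1 ≤ α`.
  obtain ⟨ε, p, hε, hp, hαp, hfin⟩ : ∃ ε p : ℝ, 0 < ε ∧ 1 ≤ p ∧ α < p ∧
      ∑' t, (rwMoment P (Θ t) α ε) ^ (1 / p) < ∞ := by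
    rcases h with ⟨_, h1, ε, hε, _, hfin⟩ | ⟨h1, ε, hε, _, hfin⟩
    · exact ⟨ε, 1, hε, le_rfl, h1, by simpa using hfin⟩
    · exact ⟨ε, α + ε, hε, by linarith, by linarith, hfin⟩
  have hp0 : 0 < 1 / p := by positivity
  have hle : ∀ t, ∫⁻ ω, ENNReal.ofReal (Θ t ω ^ α) ∂P ≤ rwMoment P (Θ t) α ε := by
    intro t
    refine lintegral_mono fun ω => ENNReal.ofReal_le_ofReal ?_
    have h0 := hpos t ω
    rcases le_total 1 (Θ t ω) with h1 | h1
    · exact (Real.rpow_le_rpow_of_exponent_le h1 (by linarith)).trans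
        (le_add_of_nonneg_right (by positivity))
    · exact (Real.rpow_le_rpow_of_exponent_ge h0 h1 (by linarith)).trans
        (le_add_of_nonneg_left (by positivity))
  have hsum : ∑' t, (∫⁻ ω, ENNReal.ofReal (Θ t ω ^ α) ∂P) ^ (1 / p) ≠ ∞ :=
    ne_top_of_le_ne_top hfin.ne
      (ENNReal.tsum_le_tsum fun t => ENNReal.rpow_le_rpow (hle t) hp0.le)
  have hlt : ∀ t, ∫⁻ ω, ENNReal.ofReal (Θ t ω ^ α) ∂P < ∞ := fun t =>
    (ENNReal.rpow_lt_top_iff_of_pos hp0).1 (ENNReal.ne_top_of_tsum_ne_top hsum t).lt_top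
  have hnn : ∀ t, 0 ≤ᵐ[P] fun ω => Θ t ω ^ α := fun t =>
    Eventually.of_forall fun ω => Real.rpow_nonneg (hpos t ω).le _
  have hmeas : ∀ t, AEStronglyMeasurable (fun ω => Θ t ω ^ α) P := fun t =>
    ((hΘ t).pow_const α).aestronglyMeasurable
  refine ⟨p, hp, hαp, fun t => ⟨hmeas t, ?_⟩, ?_⟩
  · rw [hasFiniteIntegral_iff_ofReal (hnn t)]
    exact hlt t
  · refine (ENNReal.summable_toReal hsum).congr fun t => ?_
    rw [integral_eq_lintegral_of_nonneg_ae (hnn t) (hmeas t), ENNReal.toReal_rpow]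

variable {α a β : ℝ}

theorem modExp_log_sub_log {x θ : ℝ} (hx : 0 < x) (hθ : 0 < θ) :
    modExp α a β (Real.log x - Real.log θ) =
      x ^ (-α) * (θ ^ α * (1 + a * Real.cos (β * (Real.log x - Real.log θ)))) := by
  rw [modExp, Real.rpow_def_of_pos hx, Real.rpow_def_of_pos hθ, ← mul_assoc, ← Real.exp_add]
  ring_nf

theorem rpow_mul_modExp_log_sub_log {x θ : ℝ} (hx : 0 < x) (hθ : 0 < θ) :
    x ^ α * modExp α a β (Real.log x - Real.log θ) =
      θ ^ α * (1 + a * Real.cos (β * (Real.log x - Real.log θ))) := by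
  rw [modExp_log_sub_log hx hθ, ← mul_assoc, ← Real.rpow_add hx]
  simp

theorem rpow_mul_modExp_le {x θ : ℝ} (ha : 0 ≤ a) (ha1 : a < 1) (hx : 0 < x) (hθ : 0 < θ) :
    x ^ α * modExp α a β (Real.log x - Real.log θ) ≤ 2 * θ ^ α := by
  rw [rpow_mul_modExp_log_sub_log hx hθ, mul_comm]
  gcongr
  linarith [(modFactor_bounds ha (β * (Real.log x - Real.log θ))).2]

theorem tendsto_modExp_log_sub_log (ha : 0 ≤ a) (ha1 : a < 1) (hα : 0 < α) (θ : ℝ) :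
    Tendsto (fun x => modExp α a β (Real.log x - Real.log θ)) atTop (𝓝 0) :=
  (tendsto_modExp_atTop ha ha1 hα).comp
    (tendsto_atTop_add_const_right _ _ Real.tendsto_log_atTop)

/-- This separates `x` from `θ` in the oscillation: the dependence on `x` becomes one complex factor
that comes out of the expectation and of the sum over `t`. -/
theorem rpow_mul_exp_mul_cpow_re {x θ : ℝ} (hθ : 0 < θ) :
    (Complex.exp (-(Complex.I * β * Real.log x)) *
      (θ : ℂ) ^ ((α : ℂ) + Complex.I * (β : ℂ))).re =
      θ ^ α * Real.cos (β * (Real.log x - Real.log θ)) := by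
  rw [Complex.cpow_def_of_ne_zero (by exact_mod_cast hθ.ne'), ← Complex.exp_add,
    ← Complex.ofReal_log hθ.le, Complex.exp_re, Real.rpow_def_of_pos hθ]
  congr 1
  · simp
  · rw [← Real.cos_neg]
    simp
    ring_nf

/-- Cancellation of the oscillating part of the tails at a zero of the Mellin transform. -/
theorem hasSum_integral_rpow_mul_cos {Θ : ℕ → Ω → ℝ} (hΘ : ∀ t, Measurable (Θ t))
    (hpos : ∀ t ω, 0 < Θ t ω) (hint : ∀ t, Integrable (fun ω => Θ t ω ^ α) P)
    (hM : HasSum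
      (fun t => ∫ ω, ((Θ t ω : ℝ) : ℂ) ^ ((α : ℂ) + Complex.I * (β : ℂ)) ∂P) 0) (x : ℝ) :
    HasSum (fun t => ∫ ω, Θ t ω ^ α * Real.cos (β * (Real.log x - Real.log (Θ t ω))) ∂P) 0 := by
  have h := (hM.mul_left (Complex.exp (-(Complex.I * β * Real.log x)))).mapL Complex.reCLM
  rw [mul_zero, map_zero] at h
  refine h.congr_fun fun t => ?_
  have hI : Integrable
      (fun ω => ((Θ t ω : ℝ) : ℂ) ^ ((α : ℂ) + Complex.I * (β : ℂ))) P := by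
    refine (hint t).mono' ?_ (Eventually.of_forall fun ω => ?_)
    · exact ((Complex.measurable_ofReal.comp (hΘ t)).pow_const _).aestronglyMeasurable
    · rw [Complex.norm_cpow_eq_rpow_re_of_pos (hpos t ω)]
      simp
  rw [← integral_const_mul, ← Complex.reCLM.integral_comp_comm (hI.const_mul _)]
  exact integral_congr_ae (Eventually.of_forall fun ω => (rpow_mul_exp_mul_cpow_re (hpos t ω)).symm)

/-- The sum of the tails of the weighted variables is a pure power, asymptotically. -/
theorem tendsto_rpow_mul_tsum_integral_min_modExp [IsProbabilityMeasure P] {Θ : ℕ → Ω → ℝ}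
    (hΘ : ∀ t, Measurable (Θ t)) (hpos : ∀ t ω, 0 < Θ t ω) (ha : 0 ≤ a) (ha1 : a < 1)
    (hα : 0 < α) (hint : ∀ t, Integrable (fun ω => Θ t ω ^ α) P)
    (hsum : Summable fun t => ∫ ω, Θ t ω ^ α ∂P)
    (hM : HasSum
      (fun t => ∫ ω, ((Θ t ω : ℝ) : ℂ) ^ ((α : ℂ) + Complex.I * (β : ℂ)) ∂P) 0) :
    Tendsto (fun x : ℝ => x ^ α *
      ∑' t, ∫ ω, min 1 (modExp α a β (Real.log x - Real.log (Θ t ω))) ∂P) atTop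
      (𝓝 (∑' t, ∫ ω, Θ t ω ^ α ∂P)) := by
  set H : ℝ → ℝ → ℝ := fun x θ => modExp α a β (Real.log x - Real.log θ) with hH
  have hHm : ∀ t x, Measurable fun ω => H x (Θ t ω) := fun t x =>
    continuous_modExp.measurable.comp (measurable_const.sub (hΘ t).log)
  have hH0 : ∀ x θ, 0 < H x θ := fun x θ => modExp_pos ha ha1 _
  have hHint : ∀ t x, 0 < x → Integrable (fun ω => x ^ α * H x (Θ t ω)) P := fun t x hx =>
    ((hint t).const_mul 2).mono' ((hHm t x).const_mul _).aestronglyMeasurable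
      (Eventually.of_forall fun ω => by
        rw [Real.norm_of_nonneg (mul_nonneg (by positivity) (hH0 _ _).le)]
        exact rpow_mul_modExp_le ha ha1 hx (hpos t ω))
  -- The cancellation is exact for `H` but not for `min 1 H`. The difference vanishes for large `x`
  -- at each fixed weight, and this bound lets dominated convergence be used in `ω` and then in `t`.
  have hdefect : ∀ x θ, 0 < x → 0 < θ → 0 ≤ x ^ α * (H x θ - min 1 (H x θ)) ∧
      x ^ α * (H x θ - min 1 (H x θ)) ≤ 2 * θ ^ α := by
    intro x θ hx hθ
    have hm0 : 0 ≤ min 1 (H x θ) := le_min zero_le_one (hH0 x θ).le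
    have hm1 : min 1 (H x θ) ≤ H x θ := min_le_right _ _
    refine ⟨mul_nonneg (by positivity) (by linarith), le_trans ?_ (rpow_mul_modExp_le (β := β) ha ha1 hx hθ)⟩
    change _ ≤ x ^ α * H x θ
    gcongr
    linarith
  have hdm : ∀ t x, Measurable fun ω => x ^ α * (H x (Θ t ω) - min 1 (H x (Θ t ω))) := fun t x =>
    ((hHm t x).sub (measurable_const.min (hHm t x))).const_mul _
  have hdint : ∀ t x, 0 < x →
      Integrable (fun ω => x ^ α * (H x (Θ t ω) - min 1 (H x (Θ t ω)))) P := fun t x hx =>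
    ((hint t).const_mul 2).mono' (hdm t x).aestronglyMeasurable (Eventually.of_forall fun ω => by
      rw [Real.norm_of_nonneg (hdefect x _ hx (hpos t ω)).1]
      exact (hdefect x _ hx (hpos t ω)).2)
  have hdef_lim : Tendsto
      (fun x : ℝ => ∑' t, ∫ ω, x ^ α * (H x (Θ t ω) - min 1 (H x (Θ t ω))) ∂P) atTop (𝓝 0) := by
    have key := tendsto_tsum_of_dominated_convergence (𝓕 := atTop)
      (f := fun (x : ℝ) t => ∫ ω, x ^ α * (H x (Θ t ω) - min 1 (H x (Θ t ω))) ∂P)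
      (g := fun _ : ℕ => (0 : ℝ)) (hsum.mul_left 2) (fun t => ?_) ?_
    · simpa using key
    · have key := tendsto_integral_filter_of_dominated_convergence (μ := P) (l := atTop)
        (F := fun (x : ℝ) ω => x ^ α * (H x (Θ t ω) - min 1 (H x (Θ t ω))))
        (f := fun _ => (0 : ℝ)) (fun ω => 2 * Θ t ω ^ α)
        (Eventually.of_forall fun x => (hdm t x).aestronglyMeasurable) ?_ ((hint t).const_mul 2)
        (Eventually.of_forall fun ω => ?_)
      · simpa using key
      · filter_upwards [eventually_gt_atTop 0] with x hx
        refine Eventually.of_forall fun ω => ?_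
        rw [Real.norm_of_nonneg (hdefect x _ hx (hpos t ω)).1]
        exact (hdefect x _ hx (hpos t ω)).2
      · refine tendsto_const_nhds.congr' ?_
        filter_upwards [(tendsto_modExp_log_sub_log (β := β) ha ha1 hα
          (Θ t ω)).eventually_le_const one_pos] with x hx
        rw [show min 1 (H x (Θ t ω)) = H x (Θ t ω) from min_eq_right hx, sub_self, mul_zero]
    · filter_upwards [eventually_gt_atTop 0] with x hx t
      rw [← integral_const_mul, Real.norm_of_nonneg
        (integral_nonneg fun ω => (hdefect x _ hx (hpos t ω)).1)]
      exact integral_mono (hdint t x hx) ((hint t).const_mul 2)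
        fun ω => (hdefect x _ hx (hpos t ω)).2
  have hmain := (tendsto_const_nhds (x := ∑' t, ∫ ω, Θ t ω ^ α ∂P)).sub hdef_lim
  rw [sub_zero] at hmain
  refine hmain.congr' ?_
  filter_upwards [eventually_gt_atTop 0] with x hx
  -- Without the cap at `1` the normalised sum is the same constant for every `x > 0`, not only in
  -- the limit.
  have hHsum : HasSum (fun t => ∫ ω, x ^ α * H x (Θ t ω) ∂P) (∑' t, ∫ ω, Θ t ω ^ α ∂P) := by
    have h := hsum.hasSum.add ((hasSum_integral_rpow_mul_cos hΘ hpos hint hM x).mul_left a)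
    rw [mul_zero, add_zero] at h
    refine h.congr_fun fun t => ?_
    have hc : Integrable
        (fun ω => Θ t ω ^ α * Real.cos (β * (Real.log x - Real.log (Θ t ω)))) P := by
      refine (hint t).mul_bdd (c := 1) ?_ (Eventually.of_forall fun ω => Real.abs_cos_le_one _)
      exact (((measurable_const.sub (hΘ t).log).const_mul β).cos).aestronglyMeasurable
    rw [← integral_const_mul, ← integral_add (hint t) (hc.const_mul a)]
    refine integral_congr_ae (Eventually.of_forall fun ω => ?_)
    change x ^ α * modExp α a β _ = _
    rw [rpow_mul_modExp_log_sub_log hx (hpos t ω)]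
    ring
  have hdsum : Summable fun t => ∫ ω, x ^ α * (H x (Θ t ω) - min 1 (H x (Θ t ω))) ∂P := by
    refine Summable.of_nonneg_of_le
      (fun t => integral_nonneg fun ω => (hdefect x _ hx (hpos t ω)).1) (fun t => ?_) hHsum.summable
    refine integral_mono (hdint t x hx) (hHint t x hx) fun ω => ?_
    have : 0 ≤ min 1 (H x (Θ t ω)) := le_min zero_le_one (hH0 _ _).le
    change x ^ α * _ ≤ x ^ α * _
    gcongr
    linarith
  rw [← hHsum.tsum_eq, ← hHsum.summable.tsum_sub hdsum, ← tsum_mul_left]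
  refine tsum_congr fun t => ?_
  rw [← integral_sub (hHint t x hx) (hdint t x hx), ← integral_const_mul]
  refine integral_congr_ae (Eventually.of_forall fun ω => ?_)
  simp only [hH]
  ring

/-- Two weighted independent variables are unlikely to be large together. -/
theorem tendsto_rpow_mul_integral_min_mul_min [IsProbabilityMeasure P] {θ η : Ω → ℝ}
    (hθ : Measurable θ) (hη : Measurable η) (hθ0 : ∀ ω, 0 < θ ω) (ha : 0 ≤ a) (ha1 : a < 1)
    (hα : 0 < α) (hint : Integrable (fun ω => θ ω ^ α) P) :
    Tendsto (fun x : ℝ => x ^ α * ∫ ω, min 1 (modExp α a β (Real.log x - Real.log (θ ω))) *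
      min 1 (modExp α a β (Real.log x - Real.log (η ω))) ∂P) atTop (𝓝 0) := by
  set H : ℝ → ℝ → ℝ := fun x θ => modExp α a β (Real.log x - Real.log θ) with hH
  have hHm : ∀ x (ζ : Ω → ℝ), Measurable ζ → Measurable fun ω => min 1 (H x (ζ ω)) :=
    fun x ζ hζ => measurable_const.min
      (continuous_modExp.measurable.comp (measurable_const.sub hζ.log))
  have hm0 : ∀ x θ, 0 ≤ min 1 (H x θ) := fun x θ => le_min zero_le_one (modExp_pos ha ha1 _).le
  -- The first factor absorbs all of `x ^ α`; the second, at most `1`, is left to supply the decay.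
  have hb : ∀ x ω, 0 < x → x ^ α * (min 1 (H x (θ ω)) * min 1 (H x (η ω))) ≤
      2 * θ ω ^ α * min 1 (H x (η ω)) := by
    intro x ω hx
    rw [← mul_assoc]
    refine mul_le_mul_of_nonneg_right (le_trans ?_ (rpow_mul_modExp_le (β := β) ha ha1 hx (hθ0 ω)))
      (hm0 _ _)
    gcongr
    exact min_le_right _ _
  have hb0 : ∀ x ω, 0 < x → 0 ≤ x ^ α * (min 1 (H x (θ ω)) * min 1 (H x (η ω))) := fun x ω hx =>
    mul_nonneg (by positivity) (mul_nonneg (hm0 _ _) (hm0 _ _))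
  have key := tendsto_integral_filter_of_dominated_convergence (μ := P) (l := atTop)
    (F := fun (x : ℝ) ω => x ^ α * (min 1 (H x (θ ω)) * min 1 (H x (η ω))))
    (f := fun _ => (0 : ℝ)) (fun ω => 2 * θ ω ^ α)
    (Eventually.of_forall fun x =>
      (((hHm x θ hθ).mul (hHm x η hη)).const_mul _).aestronglyMeasurable) ?_ (hint.const_mul 2)
    (Eventually.of_forall fun ω => ?_)
  · simpa only [integral_const_mul, integral_zero] using key
  · filter_upwards [eventually_gt_atTop 0] with x hx
    refine Eventually.of_forall fun ω => ?_
    rw [Real.norm_of_nonneg (hb0 x ω hx)]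
    refine (hb x ω hx).trans (mul_le_of_le_one_right ?_ (min_le_left _ _))
    have := hθ0 ω
    positivity
  · have hlim : Tendsto (fun x => 2 * θ ω ^ α * min 1 (H x (η ω))) atTop
        (𝓝 (2 * θ ω ^ α * min 1 0)) :=
      ((tendsto_const_nhds).min (tendsto_modExp_log_sub_log ha ha1 hα _)).const_mul _
    rw [min_eq_right zero_le_one, mul_zero] at hlim
    refine tendsto_of_tendsto_of_tendsto_of_le_of_le' tendsto_const_nhds hlim ?_ ?_
    · filter_upwards [eventually_gt_atTop 0] with x hx using hb0 x ω hx
    · filter_upwards [eventually_gt_atTop 0] with x hx using hb x ω hx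

end Weights

/-! ### The product extension carrying the i.i.d. sequence. -/

section Extension

variable {Ω : Type*} [MeasurableSpace Ω] {P : Measure Ω} {ν : Measure ℝ}
  [IsProbabilityMeasure ν]

theorem lt_mul_exp_iff {x θ v : ℝ} (hx : 0 < x) (hθ : 0 < θ) :
    x < θ * Real.exp v ↔ Real.log x - Real.log θ < v := by
  rw [sub_lt_iff_lt_add', ← Real.log_exp v, ← Real.log_mul hθ.ne' (Real.exp_ne_zero _),
    Real.log_lt_log_iff hx (mul_pos hθ (Real.exp_pos _)), Real.log_exp]

theorem prod_infinitePi_lt_mul_exp {θ : Ω → ℝ} (hθ : Measurable θ) (hθ0 : ∀ ω, 0 < θ ω) (t : ℕ)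
    {x : ℝ} (hx : 0 < x) :
    (P.prod (Measure.infinitePi fun _ : ℕ => ν)) {w | x < θ w.1 * Real.exp (w.2 t)} =
      ∫⁻ ω, ν (Set.Ioi (Real.log x - Real.log (θ ω))) ∂P := by
  rw [Measure.prod_apply (measurableSet_lt measurable_const (by fun_prop))]
  refine lintegral_congr fun ω => ?_
  rw [← (measurePreserving_eval_infinitePi (fun _ : ℕ => ν) t).measure_preimage
    measurableSet_Ioi.nullMeasurableSet]
  congr 1
  ext u
  exact lt_mul_exp_iff hx (hθ0 ω)

/-- For fixed `ω` two distinct coordinates are independent, so the product appears under the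
integral, whatever the joint law of `θ` and `η`. -/
theorem prod_infinitePi_lt_mul_exp_pair {θ η : Ω → ℝ} (hθ : Measurable θ) (hη : Measurable η)
    (hθ0 : ∀ ω, 0 < θ ω) (hη0 : ∀ ω, 0 < η ω) {s t : ℕ} (hst : s ≠ t) {x : ℝ} (hx : 0 < x) :
    (P.prod (Measure.infinitePi fun _ : ℕ => ν))
        {w | x < θ w.1 * Real.exp (w.2 s) ∧ x < η w.1 * Real.exp (w.2 t)} =
      ∫⁻ ω, ν (Set.Ioi (Real.log x - Real.log (θ ω))) *
        ν (Set.Ioi (Real.log x - Real.log (η ω))) ∂P := by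
  have hmeas : ∀ (ζ : Ω → ℝ) (r : ℕ), Measurable ζ →
      MeasurableSet {w : Ω × (ℕ → ℝ) | x < ζ w.1 * Real.exp (w.2 r)} := fun ζ r hζ =>
    measurableSet_lt measurable_const (by fun_prop)
  refine (Measure.prod_apply ((hmeas θ s hθ).inter (hmeas η t hη))).trans ?_
  refine lintegral_congr fun ω => ?_
  rw [← Measure.prod_prod, ← Measure.infinitePi_map_eval_prod (P := fun _ : ℕ => ν) hst,
    Measure.map_apply (by fun_prop) (measurableSet_Ioi.prod measurableSet_Ioi)]
  congr 1
  ext u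
  exact and_congr (lt_mul_exp_iff hx (hθ0 ω)) (lt_mul_exp_iff hx (hη0 ω))

variable [IsProbabilityMeasure P]

theorem iIndepFun_exp_prod_infinitePi :
    iIndepFun (fun t (w : Ω × (ℕ → ℝ)) => Real.exp (w.2 t))
      (P.prod (Measure.infinitePi fun _ : ℕ => ν)) := by
  rw [iIndepFun_iff_map_fun_eq_infinitePi_map (by fun_prop)]
  have hsnd : (P.prod (Measure.infinitePi fun _ : ℕ => ν)).map Prod.snd =
      Measure.infinitePi fun _ : ℕ => ν := by simp [Measure.map_snd_prod]
  have hexp := (iIndepFun_iff_map_fun_eq_infinitePi_map (P := Measure.infinitePi fun _ : ℕ => ν)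
    (X := fun t (u : ℕ → ℝ) => Real.exp (u t)) (by fun_prop)).1
    (iIndepFun_infinitePi (X := fun _ => Real.exp) fun _ => Real.measurable_exp)
  rw [← hsnd, Measure.map_map (by fun_prop) measurable_snd] at hexp
  refine hexp.trans ?_
  congr 1
  funext t
  rw [Measure.map_map (by fun_prop) measurable_snd]
  rfl

theorem map_exp_prod_infinitePi (t : ℕ) :
    (P.prod (Measure.infinitePi fun _ : ℕ => ν)).map (fun w => Real.exp (w.2 t)) =
      ν.map Real.exp := by
  have h : (fun w : Ω × (ℕ → ℝ) => Real.exp (w.2 t)) =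
      Real.exp ∘ (Function.eval t) ∘ Prod.snd := rfl
  rw [h, ← Measure.map_map Real.measurable_exp (by fun_prop),
    ← Measure.map_map (by fun_prop) measurable_snd]
  congr 1
  rw [show (P.prod (Measure.infinitePi fun _ : ℕ => ν)).map Prod.snd =
    Measure.infinitePi fun _ : ℕ => ν by simp [Measure.map_snd_prod]]
  exact (measurePreserving_eval_infinitePi (fun _ : ℕ => ν) t).map_eq

/-- The weighted sum has an exactly power-like tail when the Mellin transform of the weights
vanishes. -/
theorem tendsto_rpow_mul_weighted_sum {Θ : ℕ → Ω → ℝ} (hΘ : ∀ t, Measurable (Θ t))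
    (hpos : ∀ t ω, 0 < Θ t ω) {α a β p : ℝ} (ha : 0 ≤ a) (ha1 : a < 1) (hα : 0 < α)
    (hν : ∀ u, ν (Set.Ioi u) = ENNReal.ofReal (min 1 (modExp α a β u)))
    (hp : 1 ≤ p) (hαp : α < p) (hint : ∀ t, Integrable (fun ω => Θ t ω ^ α) P)
    (hsum : Summable fun t => (∫ ω, Θ t ω ^ α ∂P) ^ (1 / p))
    (hM : HasSum
      (fun t => ∫ ω, ((Θ t ω : ℝ) : ℂ) ^ ((α : ℂ) + Complex.I * (β : ℂ)) ∂P) 0) :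
    (∀ᵐ w ∂P.prod (Measure.infinitePi fun _ : ℕ => ν),
      Summable fun t => Θ t w.1 * Real.exp (w.2 t)) ∧
    Tendsto (fun x : ℝ => x ^ α * (P.prod (Measure.infinitePi fun _ : ℕ => ν)).real
      {w | x < ∑' t, Θ t w.1 * Real.exp (w.2 t)}) atTop (𝓝 (∑' t, ∫ ω, Θ t ω ^ α ∂P)) := by
  set Q := P.prod (Measure.infinitePi fun _ : ℕ => ν) with hQ
  set Z : ℕ → Ω × (ℕ → ℝ) → ℝ := fun t w => Θ t w.1 * Real.exp (w.2 t) with hZdef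
  set G : ℝ → ℝ → ℝ := fun x θ => min 1 (modExp α a β (Real.log x - Real.log θ)) with hG
  have hG0 : ∀ x θ, 0 ≤ G x θ := fun x θ => le_min zero_le_one (modExp_pos ha ha1 _).le
  have hGm : ∀ x t, Measurable fun ω => G x (Θ t ω) := fun x t =>
    measurable_const.min (continuous_modExp.measurable.comp (measurable_const.sub (hΘ t).log))
  have hm0 : ∀ t, 0 ≤ ∫ ω, Θ t ω ^ α ∂P := fun t =>
    integral_nonneg fun ω => Real.rpow_nonneg (hpos t ω).le _
  have hZ : ∀ t, Measurable (Z t) := fun t => by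
    have := hΘ t
    fun_prop
  have hZ0 : ∀ t w, 0 ≤ Z t w := fun t w => mul_nonneg (hpos t w.1).le (Real.exp_pos _).le
  -- The tail constants are `2 E[Θ_t ^ α]`, the `2` bounding the modulation `1 + a`.
  have hc : ∀ t, 0 ≤ 2 * ∫ ω, Θ t ω ^ α ∂P := fun t => mul_nonneg zero_le_two (hm0 t)
  have htail_eq : ∀ t x, 0 < x → Q {w | x < Z t w} = ∫⁻ ω, ENNReal.ofReal (G x (Θ t ω)) ∂P :=
    fun t x hx => by
      simp only [hQ, hZdef, prod_infinitePi_lt_mul_exp (hΘ t) (hpos t) t hx, hν, hG]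
  have htail : ∀ t z, 0 < z →
      Q {w | z < Z t w} ≤ ENNReal.ofReal ((2 * ∫ ω, Θ t ω ^ α ∂P) * z ^ (-α)) := by
    intro t z hz
    rw [htail_eq t z hz, mul_right_comm, ← integral_const_mul,
      ofReal_integral_eq_lintegral_ofReal ((hint t).const_mul _)
        (Eventually.of_forall fun ω => by have := hpos t ω; positivity)]
    refine lintegral_mono fun ω => ENNReal.ofReal_le_ofReal ?_
    refine (min_le_right _ _).trans ?_
    have := hpos t ω
    rw [modExp_log_sub_log hz this, mul_comm 2, mul_assoc, mul_comm 2]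
    gcongr
    linarith [(modFactor_bounds ha (β * (Real.log z - Real.log (Θ t ω)))).2]
  have hsum' : Summable fun t => (2 * ∫ ω, Θ t ω ^ α ∂P) ^ (1 / p) := by
    refine (hsum.mul_left (2 ^ (1 / p))).congr fun t => ?_
    rw [Real.mul_rpow zero_le_two (hm0 t)]
  have hpair : ∀ s t, s ≠ t →
      Tendsto (fun x : ℝ => x ^ α * Q.real {w | x < Z s w ∧ x < Z t w}) atTop (𝓝 0) := by
    intro s t hst
    refine (tendsto_rpow_mul_integral_min_mul_min (β := β) (hΘ s) (hΘ t) (hpos s) ha ha1 hα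
      (hint s)).congr' ?_
    filter_upwards [eventually_gt_atTop 0] with x hx
    rw [measureReal_def]
    simp only [hQ, hZdef, prod_infinitePi_lt_mul_exp_pair (hΘ s) (hΘ t) (hpos s) (hpos t) hst hx,
      hν]
    rw [integral_eq_lintegral_of_nonneg_ae
      (Eventually.of_forall fun ω => mul_nonneg (hG0 x (Θ s ω)) (hG0 x (Θ t ω)))
      ((hGm x s).mul (hGm x t)).aestronglyMeasurable]
    congr 2
    refine lintegral_congr fun ω => ?_
    rw [ENNReal.ofReal_mul (hG0 x (Θ s ω))]
  have hK : Tendsto (fun x : ℝ => x ^ α * ∑' t, Q.real {w | x < Z t w}) atTop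
      (𝓝 (∑' t, ∫ ω, Θ t ω ^ α ∂P)) := by
    refine (tendsto_rpow_mul_tsum_integral_min_modExp hΘ hpos ha ha1 hα hint
      (summable_of_summable_rpow_one_div hm0 hp hsum) hM).congr' ?_
    filter_upwards [eventually_gt_atTop 0] with x hx
    congr 1
    refine tsum_congr fun t => ?_
    rw [measureReal_def, htail_eq t x hx, integral_eq_lintegral_of_nonneg_ae
      (Eventually.of_forall fun ω => hG0 x (Θ t ω)) (hGm x t).aestronglyMeasurable]
  exact ⟨ae_summable_of_power_tails hZ hZ0 hc hp hα hαp htail hsum',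
    tendsto_rpow_mul_measureReal_lt_tsum hZ hZ0 hc hp hα hαp htail hsum' hpair hK⟩

end Extension

/-! ### Null sets, positivity of the limit constant, and nonvanishing of the frequency. -/

section Reduction

variable {Ω : Type*} [MeasurableSpace Ω] {P : Measure Ω}

theorem RWCondition.congr {Θ Θ' : ℕ → Ω → ℝ} (h : ∀ t, Θ' t =ᵐ[P] Θ t) {α : ℝ}
    (hRW : RWCondition P Θ α) : RWCondition P Θ' α := by
  have heq : ∀ t ε, rwMoment P (Θ' t) α ε = rwMoment P (Θ t) α ε := fun t ε => by
    refine lintegral_congr_ae ?_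
    filter_upwards [h t] with ω hω
    rw [hω]
  simpa only [RWCondition, heq] using hRW

theorem tsum_integral_rpow_pos [IsProbabilityMeasure P] {Θ : ℕ → Ω → ℝ} (hpos : ∀ t ω, 0 < Θ t ω)
    {α : ℝ} (hint : ∀ t, Integrable (fun ω => Θ t ω ^ α) P)
    (hsum : Summable fun t => ∫ ω, Θ t ω ^ α ∂P) : 0 < ∑' t, ∫ ω, Θ t ω ^ α ∂P := by
  refine hsum.tsum_pos (fun t => integral_nonneg fun ω => Real.rpow_nonneg (hpos t ω).le _) 0 ?_
  rw [integral_pos_iff_support_of_nonneg (fun ω => Real.rpow_nonneg (hpos 0 ω).le _) (hint 0)]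
  have : Function.support (fun ω => Θ 0 ω ^ α) = Set.univ :=
    Set.eq_univ_of_forall fun ω => (Real.rpow_pos_of_pos (hpos 0 ω) α).ne'
  simp [this]

/-- At `β = 0` the transform is `∑ E[Θ_t ^ α]`, which is strictly positive. -/
theorem ne_zero_of_hasSum_mellin_eq_zero [IsProbabilityMeasure P] {Θ : ℕ → Ω → ℝ}
    (hpos : ∀ t ω, 0 < Θ t ω) {α β : ℝ} (hint : ∀ t, Integrable (fun ω => Θ t ω ^ α) P)
    (hsum : Summable fun t => ∫ ω, Θ t ω ^ α ∂P)
    (hM : HasSum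
      (fun t => ∫ ω, ((Θ t ω : ℝ) : ℂ) ^ ((α : ℂ) + Complex.I * (β : ℂ)) ∂P) 0) : β ≠ 0 := by
  rintro rfl
  have h : HasSum (fun t => ((∫ ω, Θ t ω ^ α ∂P : ℝ) : ℂ)) ((0 : ℝ) : ℂ) := by
    rw [Complex.ofReal_zero]
    refine hM.congr_fun fun t => ?_
    rw [← integral_complex_ofReal]
    refine integral_congr_ae (Eventually.of_forall fun ω => ?_)
    simp [Complex.ofReal_cpow (hpos t ω).le]
  exact (tsum_integral_rpow_pos hpos hint hsum).ne' (Complex.hasSum_ofReal.1 h).tsum_eq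

end Reduction

end RandWeighted

/-! ### Assembly of the counterexample. -/

theorem mainTheorem2 {Ω : Type u} [MeasurableSpace Ω] (P : Measure Ω)
    [IsProbabilityMeasure P] (Θ : ℕ → Ω → ℝ) (hΘ : ∀ t, Measurable (Θ t))
    (hpos : ∀ t, ∀ᵐ ω ∂P, 0 < Θ t ω) (α : ℝ) (hα : 0 < α)
    (hRW : RandWeighted.RWCondition P Θ α) (β₀ : ℝ)
    (hMellin : HasSum
      (fun t => ∫ ω, ((Θ t ω : ℝ) : ℂ) ^ ((α : ℂ) + Complex.I * (β₀ : ℂ)) ∂P) 0) :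
    -- a probability space extending `(Ω, P)`, on which `Θ t` becomes `Θ t ∘ π`
    ∃ (Ω' : Type u) (_ : MeasurableSpace Ω') (P' : Measure Ω') (π : Ω' → Ω)
      (X : ℕ → Ω' → ℝ),
      IsProbabilityMeasure P' ∧
      MeasurePreserving π P' P ∧
      -- `X` is an i.i.d. sequence of positive random variables, independent of the weights
      (∀ t, Measurable (X t)) ∧
      (∀ t, ∀ᵐ ω ∂P', 0 < X t ω) ∧
      iIndepFun X P' ∧
      (∀ t, IdentDistrib (X t) (X 0) P' P') ∧
      IndepFun (fun ω t => X t ω) (fun ω t => Θ t (π ω)) P' ∧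
      -- the tail of `X 0` is not regularly varying, of any index
      (∀ r : ℝ, ¬ RandWeighted.HasRVTail P' (X 0) r) ∧
      -- the weighted sum is a.s. finite, with regularly varying tail of index `-α`
      (∀ᵐ ω ∂P', Summable (fun t => Θ t (π ω) * X t ω)) ∧
      RandWeighted.HasRVTail P' (fun ω => ∑' t, Θ t (π ω) * X t ω) (-α) := by
  -- The weights are positive only almost surely; resetting them to `1` elsewhere gives versions
  -- positive everywhere, and the conclusions about the sum are carried back through `hae`.
  obtain ⟨Φ, hΦ, hΦ0, hΦΘ⟩ : ∃ Φ : ℕ → Ω → ℝ, (∀ t, Measurable (Φ t)) ∧ (∀ t ω, 0 < Φ t ω) ∧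
      ∀ t, Φ t =ᵐ[P] Θ t := by
    refine ⟨fun t ω => if 0 < Θ t ω then Θ t ω else 1, fun t =>
      Measurable.ite (measurableSet_lt measurable_const (hΘ t)) (hΘ t) measurable_const,
      fun t ω => ?_, fun t => ?_⟩
    · dsimp only
      split_ifs with h
      · exact h
      · exact one_pos
    · filter_upwards [hpos t] with ω hω using if_pos hω
  obtain ⟨p, hp, hαp, hint, hsum⟩ :=
    RandWeighted.RWCondition.exists_summable hΦ hΦ0 (hRW.congr hΦΘ)
  have hM : HasSum
      (fun t => ∫ ω, ((Φ t ω : ℝ) : ℂ) ^ ((α : ℂ) + Complex.I * (β₀ : ℂ)) ∂P) 0 := by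
    refine hMellin.congr_fun fun t => integral_congr_ae ?_
    filter_upwards [hΦΘ t] with ω hω
    rw [hω]
  have hm := RandWeighted.summable_of_summable_rpow_one_div (fun t => integral_nonneg fun ω =>
    Real.rpow_nonneg (hΦ0 t ω).le _) hp hsum
  have hβ := RandWeighted.ne_zero_of_hasSum_mellin_eq_zero hΦ0 hint hm hM
  obtain ⟨a, ha, ha1, haβ⟩ : ∃ a : ℝ, 0 < a ∧ a < 1 ∧ a * (α + |β₀|) ≤ α := by
    have hb : 0 < |β₀| := abs_pos.2 hβ
    -- The largest amplitude keeping the tail monotone under `antitone_modExp`; it is below `1`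
    -- because `β₀ ≠ 0`.
    refine ⟨α / (α + |β₀|), by positivity, ?_, ?_⟩
    · rw [div_lt_one (by positivity)]
      linarith
    · rw [div_mul_cancel₀ _ (by positivity)]
  obtain ⟨ν, hνp, hν⟩ := RandWeighted.exists_measure_Ioi_eq_modExp ha.le ha1 hα haβ
  obtain ⟨hS, hT⟩ := RandWeighted.tendsto_rpow_mul_weighted_sum hΦ hΦ0 ha.le ha1 hα hν hp hαp
    hint hsum hM
  set Q := P.prod (Measure.infinitePi fun _ : ℕ => ν) with hQ
  have hfst : MeasurePreserving Prod.fst Q P := measurePreserving_fst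
  have hae : ∀ᵐ w ∂Q, ∀ t, Φ t w.1 = Θ t w.1 :=
    ae_all_iff.2 fun t => hfst.quasiMeasurePreserving.ae (hΦΘ t)
  refine ⟨Ω × (ℕ → ℝ), inferInstance, Q, Prod.fst, fun t w => Real.exp (w.2 t), inferInstance,
    hfst, fun t => by fun_prop, fun t => Eventually.of_forall fun w => Real.exp_pos _,
    RandWeighted.iIndepFun_exp_prod_infinitePi, fun t => ⟨by fun_prop, by fun_prop, ?_⟩, ?_,
    fun r => ?_, ?_, ?_⟩
  · rw [RandWeighted.map_exp_prod_infinitePi, RandWeighted.map_exp_prod_infinitePi]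
  · exact (indepFun_prod (X := fun (ω : Ω) t => Θ t ω)
      (Y := fun (u : ℕ → ℝ) t => Real.exp (u t)) (by fun_prop) (by fun_prop)).symm
  · refine RandWeighted.not_isRegularlyVarying_modExp ha ha1 hα hβ _ (fun x hx => ?_) r
    -- The constant weight `1` turns the weighted tail formula into the tail of `X 0` itself.
    have h := RandWeighted.prod_infinitePi_lt_mul_exp (P := P) (ν := ν) (θ := fun _ => 1)
      measurable_const (fun _ => one_pos) 0 hx
    simp only [one_mul, Real.log_one, sub_zero, lintegral_const, measure_univ, mul_one, hν] at h
    rw [measureReal_def, hQ, h, ENNReal.toReal_ofReal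
      (le_min zero_le_one (RandWeighted.modExp_pos ha.le ha1 _).le)]
  · filter_upwards [hS, hae] with w hw hw'
    simpa only [hw'] using hw
  · refine RandWeighted.isRegularlyVarying_of_tendsto
      (RandWeighted.tsum_integral_rpow_pos hΦ0 hint hm) (hT.congr fun x => ?_)
    congr 1
    refine measureReal_congr ?_
    filter_upwards [hae] with w hw
    change (x < ∑' t, Φ t w.1 * Real.exp (w.2 t)) = (x < ∑' t, Θ t w.1 * Real.exp (w.2 t))
    simp only [hw]
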